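/- Let $\mathbb{K}$ be a field and let $Q$, $Q'$ be finite quivers (finitely many vertices and edges; loops and multiple edges are allowed). Let $\mathbb{K}Q$ be the path algebra of $Q$, with basis all directed paths in $Q$, including the trivial path at each vertex. Let $\mathcal{C}(Q)=\mathbb{K}Q/C$ be the commuting algebra, where the parallel ideal $C$ is the two-sided ideal generated by all differences $p-q$ of paths $p,q$ in $Q$ (trivial paths included) with the same source and the same target. Let $\mathcal{R}(Q)$ be the reachability poset: its elements are the classes of vertices of $Q$ for the relation "there are directed paths from $v$ to $w$ and from $w$ to $v$", and $[v]\le[w]$ if and only if there is a directed path (possibly trivial) from $v$ to $w$. Define $\mathcal{C}(Q')$ and $\mathcal{R}(Q')$ in the same way. Then $\mathcal{C}(Q)$ and $\mathcal{C}(Q')$ are Morita equivalent if and only if the posets $\mathcal{R}(Q)$ and $\mathcal{R}(Q')$ are isomorphic. This holds both when Morita equivalence is meant for rings (the categories of left modules are equivalent) and when it is meant for $\mathbb{K}$-algebras (there is a $\mathbb{K}$-linear such equivalence). -/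

import Mathlib

open CategoryTheory

universe u v w

/-- A morphism of `C`, together with its source and its target. -/
structure CatMor (C : Type u) [Category.{v} C] where
  src : C
  tgt : C
  hom : src ⟶ tgt

/-- The category algebra `R C`: the free `R`-module on the set of all morphisms of `C`,
with the product `f · g = f ∘ g` of composable basis elements, and `f · g = 0` if `f` and `g`
are not composable. -/
def CategoryAlgebra (R : Type w) [CommRing R] (C : Type u) [Category.{v} C] :
    Type (max u v w) :=
  CatMor C →₀ R

namespace CategoryAlgebra

section

variable (R : Type w) [CommRing R] {C : Type u} [Category.{v} C]

noncomputable instance : AddCommGroup (CategoryAlgebra R C) :=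
  inferInstanceAs (AddCommGroup (CatMor C →₀ R))

noncomputable instance : Module R (CategoryAlgebra R C) :=
  inferInstanceAs (Module R (CatMor C →₀ R))

/-- The basis element of the category algebra given by a morphism. -/
noncomputable def ofHom {a b : C} (f : a ⟶ b) : CategoryAlgebra R C :=
  Finsupp.single (⟨a, b, f⟩ : CatMor C) (1 : R)

open Classical in
/-- The product of two basis elements: `f ∘ g` (first `g`, then `f`) if the target of `g` is the
source of `f`, and `0` otherwise. -/
noncomputable def basisMul (f g : CatMor C) : CategoryAlgebra R C :=
  if h : g.tgt = f.src then ofHom R (g.hom ≫ eqToHom h ≫ f.hom) else 0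

/-- The bilinear extension of the product of basis elements. -/
noncomputable def mulBilin :
    CategoryAlgebra R C →ₗ[R] CategoryAlgebra R C →ₗ[R] CategoryAlgebra R C :=
  Finsupp.linearCombination R
    (fun f : CatMor C => Finsupp.linearCombination R (fun g : CatMor C => basisMul R f g))

noncomputable instance : Mul (CategoryAlgebra R C) := ⟨fun x y => mulBilin R x y⟩

/-- The unit is the sum of all identities (a finite sum, if there are finitely many objects). -/
noncomputable instance : One (CategoryAlgebra R C) := ⟨∑ᶠ c : C, ofHom R (𝟙 c)⟩

theorem mul_def (x y : CategoryAlgebra R C) : x * y = mulBilin R x y := rfl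

theorem one_def : (1 : CategoryAlgebra R C) = ∑ᶠ c : C, ofHom R (𝟙 c) := rfl

theorem mulBilin_ofHom {a b c d : C} (f : a ⟶ b) (g : c ⟶ d) :
    mulBilin R (ofHom R f) (ofHom R g) = basisMul R ⟨a, b, f⟩ ⟨c, d, g⟩ := by
  unfold mulBilin ofHom
  erw [Finsupp.linearCombination_single, one_smul, Finsupp.linearCombination_single, one_smul]

theorem ofHom_mul_ofHom {a b c : C} (f : b ⟶ c) (g : a ⟶ b) :
    ofHom R f * ofHom R g = ofHom R (g ≫ f) := by
  rw [mul_def, mulBilin_ofHom]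
  simp [basisMul]

theorem ofHom_mul_ofHom_of_ne {a b c d : C} (f : a ⟶ b) (g : c ⟶ d) (h : d ≠ a) :
    ofHom R f * ofHom R g = 0 := by
  rw [mul_def, mulBilin_ofHom]
  simp [basisMul, h]

theorem induction_on {p : CategoryAlgebra R C → Prop} (x : CategoryAlgebra R C)
    (zero : p 0) (add : ∀ y z, p y → p z → p (y + z))
    (smul : ∀ (r : R) (a b : C) (f : a ⟶ b), p (r • ofHom R f)) : p x := by
  refine Finsupp.induction_linear (motive := p) x zero add ?_
  rintro ⟨a, b, f⟩ r
  have h := smul r a b f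
  unfold ofHom at h
  erw [Finsupp.smul_single, smul_eq_mul, mul_one] at h
  exact h

theorem mul_add' (x y z : CategoryAlgebra R C) : x * (y + z) = x * y + x * z := by
  simp [mul_def]

theorem add_mul' (x y z : CategoryAlgebra R C) : (x + y) * z = x * z + y * z := by
  simp [mul_def]

theorem zero_mul' (x : CategoryAlgebra R C) : 0 * x = 0 := by simp [mul_def]

theorem mul_zero' (x : CategoryAlgebra R C) : x * 0 = 0 := by simp [mul_def]

theorem smul_mul' (r : R) (x y : CategoryAlgebra R C) : (r • x) * y = r • (x * y) := by
  simp [mul_def]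

theorem mul_smul' (r : R) (x y : CategoryAlgebra R C) : x * (r • y) = r • (x * y) := by
  simp [mul_def]

theorem mul_assoc' (x y z : CategoryAlgebra R C) : x * y * z = x * (y * z) := by
  induction x using induction_on with
  | zero => simp only [zero_mul']
  | add x₁ x₂ h₁ h₂ => simp only [add_mul', h₁, h₂]
  | smul r a b f =>
  induction y using induction_on with
  | zero => simp only [zero_mul', mul_zero']
  | add y₁ y₂ h₁ h₂ => simp only [add_mul', mul_add', h₁, h₂]
  | smul s c d g =>
  induction z using induction_on with
  | zero => simp only [mul_zero']
  | add z₁ z₂ h₁ h₂ => simp only [mul_add', h₁, h₂]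
  | smul t p q h =>
  simp only [smul_mul', mul_smul']
  congr 3
  by_cases h₁ : d = a
  · subst h₁
    rw [ofHom_mul_ofHom]
    by_cases h₂ : q = c
    · subst h₂
      rw [ofHom_mul_ofHom, ofHom_mul_ofHom, ofHom_mul_ofHom, Category.assoc]
    · rw [ofHom_mul_ofHom_of_ne R _ _ h₂, ofHom_mul_ofHom_of_ne R _ _ h₂, mul_zero']
  · rw [ofHom_mul_ofHom_of_ne R _ _ h₁, zero_mul']
    by_cases h₂ : q = c
    · subst h₂
      rw [ofHom_mul_ofHom, ofHom_mul_ofHom_of_ne R _ _ h₁]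
    · rw [ofHom_mul_ofHom_of_ne R _ _ h₂, mul_zero']

theorem one_mul' [Finite C] (x : CategoryAlgebra R C) : 1 * x = x := by
  classical
  have := Fintype.ofFinite C
  induction x using induction_on with
  | zero => exact mul_zero' R _
  | add y z hy hz => rw [mul_add', hy, hz]
  | smul r a b f =>
  rw [mul_smul', one_def, finsum_eq_sum_of_fintype, mul_def, map_sum, LinearMap.sum_apply,
    Finset.sum_eq_single b]
  · rw [← mul_def, ofHom_mul_ofHom, Category.comp_id]
  · intro c _ hc
    rw [← mul_def, ofHom_mul_ofHom_of_ne R _ _ hc.symm]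
  · simp

theorem mul_one' [Finite C] (x : CategoryAlgebra R C) : x * 1 = x := by
  classical
  have := Fintype.ofFinite C
  induction x using induction_on with
  | zero => exact zero_mul' R _
  | add y z hy hz => rw [add_mul', hy, hz]
  | smul r a b f =>
  rw [smul_mul', one_def, finsum_eq_sum_of_fintype, mul_def, map_sum, Finset.sum_eq_single a]
  · rw [← mul_def, ofHom_mul_ofHom, Category.id_comp]
  · intro c _ hc
    rw [← mul_def, ofHom_mul_ofHom_of_ne R _ _ hc]
  · simp

end

variable (R : Type w) [CommRing R] (C : Type u) [Category.{v} C] [Finite C]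

/-- The category algebra of a category with finitely many objects is a unital ring. -/
noncomputable instance : Ring (CategoryAlgebra R C) :=
  { (inferInstance : AddCommGroup (CategoryAlgebra R C)),
    (inferInstance : Mul (CategoryAlgebra R C)),
    (inferInstance : One (CategoryAlgebra R C)) with
    left_distrib := mul_add' R
    right_distrib := add_mul' R
    zero_mul := zero_mul' R
    mul_zero := mul_zero' R
    mul_assoc := mul_assoc' R
    one_mul := one_mul' R
    mul_one := mul_one' R }

noncomputable instance : Algebra R (CategoryAlgebra R C) :=
  Algebra.ofModule (smul_mul' R) (mul_smul' R)

end CategoryAlgebra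

instance instFinitePaths (V : Type u) [Finite V] : Finite (Paths V) :=
  inferInstanceAs (Finite V)

/-- The path algebra `R Q`: the category algebra of the category of paths (including the trivial
path at each vertex) of the quiver. -/
abbrev PathAlgebra (R : Type w) [CommRing R] (V : Type u) [Quiver.{v} V] : Type (max u v w) :=
  CategoryAlgebra R (Paths V)

/-- A path in a quiver, as an element of the path algebra. -/
noncomputable def PathAlgebra.ofPath (R : Type w) [CommRing R] {V : Type u} [Quiver.{v} V]
    {a b : V} (p : Quiver.Path a b) : PathAlgebra R V :=
  CategoryAlgebra.ofHom R (C := Paths V) (a := a) (b := b) p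

/-- The parallel ideal: the two-sided ideal of the path algebra generated by the differences of all
pairs of paths with the same source and the same target. -/
noncomputable def parallelIdeal (R : Type w) [CommRing R] (V : Type u) [Quiver.{v} V] [Finite V] :
    TwoSidedIdeal (PathAlgebra R V) :=
  TwoSidedIdeal.span {x | ∃ (a b : V) (p q : Quiver.Path a b),
    x = PathAlgebra.ofPath R p - PathAlgebra.ofPath R q}

/-- The commuting algebra: the path algebra modulo its parallel ideal. -/
abbrev CommutingAlgebra (R : Type w) [CommRing R] (V : Type u) [Quiver.{v} V] [Finite V] :
    Type (max u v w) :=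
  (parallelIdeal R V).ringCon.Quotient

/-- The vertices of a quiver, preordered by reachability. As a category, this preorder is the
reachability category of the quiver. -/
def Reach (V : Type u) : Type u := V

instance instPreorderReach (V : Type u) [Quiver.{v} V] : Preorder (Reach V) where
  le a b := Quiver.Reachable (V := V) a b
  le_refl a := Quiver.Reachable.refl (V := V) a
  le_trans _ _ _ h₁ h₂ := Quiver.Reachable.trans (V := V) h₁ h₂

/-- The reachability poset: the quotient of the reachability preorder by the relation identifying
`a` and `b` if `a ≤ b` and `b ≤ a`. -/
abbrev ReachabilityPoset (V : Type u) [Quiver.{v} V] : Type u :=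
  Antisymmetrization (Reach V) (· ≤ ·)

namespace CategoryAlgebra

section lift

variable {R : Type w} [CommRing R] {C : Type u} [Category.{v} C] {B : Type*} [Ring B] [Algebra R B]

/-- The linear map out of the category algebra with prescribed values on morphisms. -/
noncomputable def liftLinear (φ : ∀ {a b : C}, (a ⟶ b) → B) : CategoryAlgebra R C →ₗ[R] B :=
  Finsupp.linearCombination R (fun f : CatMor C => φ f.hom)

theorem liftLinear_ofHom (φ : ∀ {a b : C}, (a ⟶ b) → B) {a b : C} (f : a ⟶ b) :
    liftLinear φ (ofHom R f) = φ f := by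
  unfold liftLinear ofHom
  erw [Finsupp.linearCombination_single, one_smul]

theorem liftLinear_mul (φ : ∀ {a b : C}, (a ⟶ b) → B)
    (hcomp : ∀ {a b c : C} (f : b ⟶ c) (g : a ⟶ b), φ f * φ g = φ (g ≫ f))
    (hzero : ∀ {a b c d : C} (f : a ⟶ b) (g : c ⟶ d), d ≠ a → φ f * φ g = 0)
    (x y : CategoryAlgebra R C) :
    liftLinear φ (x * y) = liftLinear φ x * liftLinear φ y := by
  induction x using induction_on with
  | zero => rw [zero_mul', map_zero, zero_mul]
  | add x₁ x₂ h₁ h₂ => rw [add_mul', map_add, map_add, add_mul, h₁, h₂]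
  | smul r a b f =>
  induction y using induction_on with
  | zero => rw [mul_zero', map_zero, mul_zero]
  | add y₁ y₂ h₁ h₂ => rw [mul_add', map_add, map_add, mul_add, h₁, h₂]
  | smul s c d g =>
  rw [smul_mul', mul_smul', map_smul, map_smul, map_smul, map_smul, smul_mul_assoc,
    mul_smul_comm, liftLinear_ofHom, liftLinear_ofHom]
  by_cases h : d = a
  · subst h
    rw [ofHom_mul_ofHom, liftLinear_ofHom, hcomp]
  · rw [ofHom_mul_ofHom_of_ne R _ _ h, hzero _ _ h, map_zero]

/-- The algebra homomorphism out of the category algebra with prescribed values on morphisms. -/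
noncomputable def lift [Finite C] (φ : ∀ {a b : C}, (a ⟶ b) → B)
    (hcomp : ∀ {a b c : C} (f : b ⟶ c) (g : a ⟶ b), φ f * φ g = φ (g ≫ f))
    (hzero : ∀ {a b c d : C} (f : a ⟶ b) (g : c ⟶ d), d ≠ a → φ f * φ g = 0)
    (hone : ∑ᶠ c : C, φ (𝟙 c) = 1) : CategoryAlgebra R C →ₐ[R] B :=
  AlgHom.ofLinearMap (liftLinear φ)
    (by
      have := Fintype.ofFinite C
      rw [finsum_eq_sum_of_fintype] at hone
      rw [one_def, finsum_eq_sum_of_fintype, map_sum, ← hone]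
      exact Finset.sum_congr rfl fun c _ => liftLinear_ofHom φ (𝟙 c))
    (liftLinear_mul φ hcomp hzero)

theorem lift_ofHom [Finite C] (φ : ∀ {a b : C}, (a ⟶ b) → B) (hcomp) (hzero) (hone)
    {a b : C} (f : a ⟶ b) :
    lift (R := R) φ hcomp hzero hone (ofHom R f) = φ f :=
  liftLinear_ofHom φ f

end lift

end CategoryAlgebra

instance instFiniteReach (V : Type u) [Finite V] : Finite (Reach V) :=
  inferInstanceAs (Finite V)

namespace CommutingAlgebra

section

variable (K : Type w) [CommRing K] {V : Type u} [Quiver.{v} V] [Finite V]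

/-- The class of a path in the commuting algebra. -/
noncomputable def ofPath {x y : V} (p : Quiver.Path x y) : CommutingAlgebra K V :=
  (parallelIdeal K V).ringCon.mkₐ K (PathAlgebra.ofPath K p)

theorem ofPath_eq_ofPath {x y : V} (p q : Quiver.Path x y) : ofPath K p = ofPath K q := by
  refine (RingCon.eq _).2 ?_
  rw [TwoSidedIdeal.rel_iff]
  exact TwoSidedIdeal.subset_span ⟨x, y, p, q, rfl⟩

/-- The common class in the commuting algebra of all paths from `x` to `y`. -/
noncomputable def arrow {x y : Reach V} (h : x ≤ y) : CommutingAlgebra K V :=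
  ofPath K (V := V) (x := x) (y := y) (Classical.choice h)

theorem ofPath_eq_arrow {x y : V} (p : Quiver.Path x y) :
    ofPath K p = arrow K (x := (x : Reach V)) (y := (y : Reach V)) ⟨p⟩ :=
  ofPath_eq_ofPath K _ _

theorem arrow_mul_arrow {x y z : Reach V} (h : y ≤ z) (h' : x ≤ y) :
    arrow K h * arrow K h' = arrow K (h'.trans h) := by
  refine (map_mul ((parallelIdeal K V).ringCon.mkₐ K) _ _).symm.trans ?_
  refine (congrArg _ (CategoryAlgebra.ofHom_mul_ofHom K (C := Paths V) _ _)).trans ?_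
  exact ofPath_eq_ofPath K (V := V) _ _

theorem arrow_mul_arrow_of_ne {x y z t : Reach V} (h : x ≤ y) (h' : z ≤ t) (hne : t ≠ x) :
    arrow K h * arrow K h' = 0 := by
  refine (map_mul ((parallelIdeal K V).ringCon.mkₐ K) _ _).symm.trans ?_
  exact (congrArg _ (CategoryAlgebra.ofHom_mul_ofHom_of_ne K (C := Paths V) _ _ hne)).trans
    (map_zero _)

theorem finsum_arrow : ∑ᶠ x : Reach V, arrow K (le_refl x) = 1 := by
  have : Fintype V := Fintype.ofFinite V
  have : Fintype (Paths V) := Fintype.ofFinite _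
  have : Fintype (Reach V) := Fintype.ofFinite _
  rw [← map_one ((parallelIdeal K V).ringCon.mkₐ K), CategoryAlgebra.one_def,
    finsum_eq_sum_of_fintype, finsum_eq_sum_of_fintype, map_sum]
  refine Fintype.sum_equiv (show Reach V ≃ Paths V from Equiv.refl V) _ _ fun x => ?_
  exact (ofPath_eq_arrow K (V := V) (x := x) Quiver.Path.nil).symm

theorem sum_arrow [Fintype (Reach V)] : ∑ x : Reach V, arrow K (le_refl x) = 1 := by
  rw [← finsum_eq_sum_of_fintype, finsum_arrow]

variable {K} in
theorem induction_on {p : CommutingAlgebra K V → Prop} (a : CommutingAlgebra K V)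
    (zero : p 0) (add : ∀ b c, p b → p c → p (b + c))
    (smul : ∀ (r : K) (x y : Reach V) (h : x ≤ y), p (r • arrow K h)) : p a := by
  obtain ⟨a, rfl⟩ := RingCon.mkₐ_surjective (α := K) (parallelIdeal K V).ringCon a
  induction a using CategoryAlgebra.induction_on with
  | zero => rwa [map_zero]
  | add y z hy hz => rw [map_add]; exact add _ _ hy hz
  | smul r x y f =>
    rw [map_smul]
    have := smul r (x : V) (y : V) ⟨f⟩
    rw [← ofPath_eq_arrow K (V := V) (x := (x : V)) (y := (y : V)) f] at this
    exact this

variable {B : Type*} [Ring B] [Algebra K B]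

/-- The algebra homomorphism out of the commuting algebra with prescribed values on arrows. -/
noncomputable def lift (φ : ∀ {x y : Reach V}, x ≤ y → B)
    (hcomp : ∀ {x y z : Reach V} (h : y ≤ z) (h' : x ≤ y), φ h * φ h' = φ (h'.trans h))
    (hzero : ∀ {x y z t : Reach V} (h : x ≤ y) (h' : z ≤ t), t ≠ x → φ h * φ h' = 0)
    (hone : ∑ᶠ x : Reach V, φ (le_refl x) = 1) : CommutingAlgebra K V →ₐ[K] B :=
  RingCon.liftₐ _
    (CategoryAlgebra.lift (R := K) (C := Paths V)
      (fun {a b} (f : a ⟶ b) => φ (x := (a : V)) (y := (b : V)) ⟨f⟩)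
      (fun _ _ => hcomp _ _) (fun _ _ h => hzero _ _ h) hone)
    (by
      have key : parallelIdeal K V ≤ TwoSidedIdeal.ker
          (CategoryAlgebra.lift (R := K) (C := Paths V)
          (fun {a b} (f : a ⟶ b) => φ (x := (a : V)) (y := (b : V)) ⟨f⟩)
          (fun _ _ => hcomp _ _) (fun _ _ h => hzero _ _ h) hone) := by
        refine TwoSidedIdeal.span_le.2 ?_
        rintro _ ⟨a, b, p, q, rfl⟩
        rw [SetLike.mem_coe, TwoSidedIdeal.mem_ker, map_sub]
        unfold PathAlgebra.ofPath
        erw [CategoryAlgebra.lift_ofHom, CategoryAlgebra.lift_ofHom, sub_self]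
      intro a b hab
      rw [TwoSidedIdeal.rel_iff] at hab
      have := key hab
      rw [TwoSidedIdeal.mem_ker, map_sub, sub_eq_zero] at this
      exact this)

theorem lift_arrow (φ : ∀ {x y : Reach V}, x ≤ y → B) (hcomp) (hzero) (hone)
    {x y : Reach V} (h : x ≤ y) :
    lift K (V := V) φ hcomp hzero hone (arrow K h) = φ h :=
  CategoryAlgebra.lift_ofHom (R := K) (C := Paths V)
    (fun {a b} (f : a ⟶ b) => φ (x := (a : V)) (y := (b : V)) ⟨f⟩)
    (fun _ _ => hcomp _ _) (fun _ _ h => hzero _ _ h) hone _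

theorem arrow_ne_zero [Nontrivial K] {x y : Reach V} (h : x ≤ y) : arrow K h ≠ 0 := by
  classical
  have : Fintype (Reach V) := Fintype.ofFinite _
  let ψ : CommutingAlgebra K V →ₐ[K] Matrix (Reach V) (Reach V) K :=
    lift K (fun {x y} _ => Matrix.single y x 1)
      (fun _ _ => by simp)
      (fun _ _ hne => Matrix.single_mul_single_of_ne _ _ _ _ hne.symm _)
      (by rw [finsum_eq_sum_of_fintype]; exact Matrix.sum_single_one)
  intro h0
  have h1 : ψ (arrow K h) = Matrix.single y x 1 := lift_arrow K _ _ _ _ h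
  rw [h0, map_zero] at h1
  have := congr_fun₂ h1 y x
  simp at this

end

end CommutingAlgebra

namespace CommutingAlgebra

open scoped ModuleCat.Algebra

section

variable {K : Type w} [CommRing K] {V : Type u} [Quiver.{v} V] [Finite V]

/-- The part of a module over the commuting algebra that is supported at the vertex `x`. -/
noncomputable def component (M : ModuleCat.{max u v w} (CommutingAlgebra K V)) (x : Reach V) :
    Submodule K M where
  carrier := {m | arrow K (le_refl x) • m = m}
  add_mem' := by
    intro a b ha hb
    rw [Set.mem_ofPred_eq] at *
    rw [smul_add, ha, hb]
  zero_mem' := smul_zero _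
  smul_mem' := by
    intro c m hm
    rw [Set.mem_ofPred_eq] at *
    rw [smul_comm, hm]

theorem mem_component {M : ModuleCat.{max u v w} (CommutingAlgebra K V)} {x : Reach V} {m : M} :
    m ∈ component M x ↔ arrow K (le_refl x) • m = m := Iff.rfl

theorem arrow_smul_mem_component (M : ModuleCat.{max u v w} (CommutingAlgebra K V))
    {x y : Reach V} (h : x ≤ y) (m : M) : arrow K h • m ∈ component M y := by
  rw [mem_component, ← mul_smul, arrow_mul_arrow]

theorem sum_arrow_smul [Fintype (Reach V)] {M : ModuleCat.{max u v w} (CommutingAlgebra K V)}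
    (m : M) : ∑ x : Reach V, arrow K (le_refl x) • m = m := by
  rw [← Finset.sum_smul, sum_arrow, one_smul]

/-- The representation of the reachability category given by a module over the commuting
algebra. -/
noncomputable def representation (M : ModuleCat.{max u v w} (CommutingAlgebra K V)) :
    Reach V ⥤ ModuleCat.{max u v w} K where
  obj x := ModuleCat.of K (component M x)
  map {x y} f := ModuleCat.ofHom
    { toFun := fun m => ⟨arrow K (leOfHom f) • (m : M), arrow_smul_mem_component M _ _⟩
      map_add' := fun _ _ => Subtype.ext (smul_add _ _ _)
      map_smul' := fun c m => Subtype.ext (smul_comm (arrow K (leOfHom f)) c (m : M)) }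
  map_id x := by
    refine ModuleCat.hom_ext (LinearMap.ext fun m : component M x => Subtype.ext m.2)
  map_comp f g := by
    refine ModuleCat.hom_ext (LinearMap.ext fun m : component M _ => Subtype.ext ?_)
    change arrow K _ • (m : M) = arrow K (leOfHom g) • arrow K (leOfHom f) • (m : M)
    rw [← mul_smul, arrow_mul_arrow]

variable (K V) in
/-- The functor from modules over the commuting algebra to representations of the reachability
category. -/
noncomputable def representationFunctor :
    ModuleCat.{max u v w} (CommutingAlgebra K V) ⥤ (Reach V ⥤ ModuleCat.{max u v w} K) where
  obj := representation
  map {M N} f :=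
    { app := fun x => ModuleCat.ofHom
        { toFun := fun m => ⟨f.hom (m : M), by
            have := m.2
            rw [mem_component] at this ⊢
            rw [← map_smul, this]⟩
          map_add' := fun _ _ => Subtype.ext (map_add f.hom _ _)
          map_smul' := fun c m => Subtype.ext (map_smul f.hom (algebraMap K _ c) (m : M)) }
      naturality := fun x y g => by
        refine ModuleCat.hom_ext (LinearMap.ext fun m : component M x => Subtype.ext ?_)
        exact map_smul f.hom _ (m : M) }
  map_id _ := rfl
  map_comp _ _ := rfl

instance : (representationFunctor K V).Additive where
  map_add := rfl

instance : (representationFunctor K V).Linear K where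
  map_smul _ _ := rfl

instance : (representationFunctor K V).Faithful where
  map_injective {M N} f g h := by
    have : Fintype (Reach V) := Fintype.ofFinite _
    ext m
    have key : ∀ x : Reach V, f.hom (arrow K (le_refl x) • m) = g.hom (arrow K (le_refl x) • m) := by
      intro x
      have := congrArg (fun η : representation M ⟶ representation N => ((η.app x).hom
        (⟨_, arrow_smul_mem_component M (le_refl x) m⟩ : component M x) : component N x).1) h
      exact this
    rw [← sum_arrow_smul m, map_sum, map_sum]
    exact Finset.sum_congr rfl fun x _ => key x

instance : (representationFunctor K V).Full where
  map_surjective {M N} η := by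
    classical
    have : Fintype (Reach V) := Fintype.ofFinite _
    let η' (x : Reach V) : component M x →ₗ[K] component N x := (η.app x).hom
    have nat : ∀ {x y : Reach V} (h : x ≤ y) (m : component M x),
        (η' y ⟨_, arrow_smul_mem_component M h m⟩ : N) = arrow K h • (η' x m : N) := fun h m =>
      congrArg (fun z => (z : component N _).1) (ConcreteCategory.congr_hom (η.naturality (homOfLE h)) m)
    let pr (x : Reach V) : M →+ component M x :=
      { toFun := fun m => ⟨_, arrow_smul_mem_component M (le_refl x) m⟩
        map_zero' := Subtype.ext (smul_zero _)
        map_add' := fun _ _ => Subtype.ext (smul_add _ _ _) }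
    let F : M →+ N := ∑ x, ((component N x).subtype.toAddMonoidHom.comp
      (η' x).toAddMonoidHom).comp (pr x)
    have hF : ∀ m, F m = ∑ x, (η' x (pr x m) : N) := fun m => by
      simp only [F, AddMonoidHom.finsetSum_apply]
      rfl
    have pr_of_ne : ∀ {x y : Reach V} (m : M), m ∈ component M y → y ≠ x → pr x m = 0 := by
      intro x y m hm hne
      refine Subtype.ext ?_
      change arrow K (le_refl x) • m = 0
      rw [← mem_component.1 hm, ← mul_smul, arrow_mul_arrow_of_ne K _ _ hne, zero_smul]
    have pr_self : ∀ {x : Reach V} (m : component M x), pr x m = m := fun m => Subtype.ext m.2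
    have F_component : ∀ {x : Reach V} (m : component M x), F m = (η' x m : N) := by
      intro x m
      rw [hF, Finset.sum_eq_single x, pr_self]
      · intro y _ hne
        rw [pr_of_ne _ m.2 hne.symm, map_zero, ZeroMemClass.coe_zero]
      · simp
    have F_arrow : ∀ {x y : Reach V} (h : x ≤ y) (m : M),
        F (arrow K h • m) = arrow K h • F m := by
      intro x y h m
      have h1 : arrow K h • m = arrow K h • (pr x m : M) := by
        change _ = arrow K h • arrow K (le_refl x) • m
        rw [← mul_smul, arrow_mul_arrow]
      rw [h1, F_component ⟨_, arrow_smul_mem_component M h (pr x m)⟩, nat, hF, Finset.smul_sum,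
        Finset.sum_eq_single x]
      · intro z _ hne
        rw [← mem_component.1 (η' z (pr z m)).2, ← mul_smul,
          arrow_mul_arrow_of_ne K _ _ hne, zero_smul]
      · simp
    have F_alg : ∀ (c : K) (m : M), F (c • m) = c • F m := by
      intro c m
      rw [hF, hF, Finset.smul_sum]
      refine Finset.sum_congr rfl fun x _ => ?_
      have : pr x (c • m) = c • pr x m := Subtype.ext (smul_comm (arrow K (le_refl x)) c m)
      rw [this, map_smul]
      rfl
    have F_smul : ∀ (a : CommutingAlgebra K V) (m : M), F (a • m) = a • F m := by
      intro a m
      induction a using induction_on with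
      | zero => rw [zero_smul, zero_smul, map_zero]
      | add b c hb hc => rw [add_smul, add_smul, map_add, hb, hc]
      | smul r x y h => rw [smul_assoc, smul_assoc, F_alg, F_arrow]
    refine ⟨ModuleCat.ofHom { toFun := F, map_add' := map_add F, map_smul' := F_smul }, ?_⟩
    ext x m
    exact Subtype.ext (F_component (x := x) m)

/-- The action of the commuting algebra on the product of the values of a representation. -/
noncomputable def totalAction (G : Reach V ⥤ ModuleCat.{max u v w} K) :
    CommutingAlgebra K V →ₐ[K] Module.End K (∀ x, G.obj x) := by
  classical
  exact lift K
    (fun {x y} h => (LinearMap.single K (fun x => G.obj x) y).comp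
      ((G.map (homOfLE h)).hom.comp (LinearMap.proj x)))
    (fun {x y z} h h' => by
      refine LinearMap.ext fun m => ?_
      change Pi.single (M := fun x => G.obj x) z ((G.map (homOfLE h)).hom (Pi.single (M := fun x => G.obj x) y
        ((G.map (homOfLE h')).hom (m x)) y)) = Pi.single (M := fun x => G.obj x) z ((G.map (homOfLE _)).hom (m x))
      rw [Pi.single_eq_same, ← homOfLE_comp h' h, G.map_comp]
      rfl)
    (fun {x y z t} h h' hne => by
      refine LinearMap.ext fun m => ?_
      change Pi.single (M := fun x => G.obj x) y ((G.map (homOfLE h)).hom (Pi.single (M := fun x => G.obj x) t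
        ((G.map (homOfLE h')).hom (m z)) x)) = 0
      rw [Pi.single_eq_of_ne hne.symm, map_zero, Pi.single_zero])
    (by
      have : Fintype (Reach V) := Fintype.ofFinite _
      rw [finsum_eq_sum_of_fintype]
      refine LinearMap.ext fun m => ?_
      rw [LinearMap.sum_apply]
      change ∑ x, Pi.single (M := fun x => G.obj x) x ((G.map (𝟙 x)).hom (m x)) = m
      simp only [G.map_id, ModuleCat.hom_id, LinearMap.id_apply]
      exact Finset.univ_sum_single m)

theorem totalAction_arrow [inst : DecidableEq (Reach V)] (G : Reach V ⥤ ModuleCat.{max u v w} K)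
    {x y : Reach V} (h : x ≤ y) (m : ∀ x, G.obj x) :
    totalAction G (arrow K h) m = Pi.single (M := fun x => G.obj x) y ((G.map (homOfLE h)).hom (m x)) := by
  unfold totalAction
  rw [lift_arrow]
  obtain rfl : inst = fun a b => Classical.propDecidable (a = b) := Subsingleton.elim _ _
  rfl

/-- The module over the commuting algebra given by a representation of the reachability
category. -/
noncomputable def totalModule (G : Reach V ⥤ ModuleCat.{max u v w} K) :
    ModuleCat.{max u v w} (CommutingAlgebra K V) :=
  letI : Module (CommutingAlgebra K V) (∀ x, G.obj x) :=
    Module.compHom _ (totalAction G).toRingHom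
  ModuleCat.of (CommutingAlgebra K V) (∀ x, G.obj x)

theorem totalModule_algebra_smul (G : Reach V ⥤ ModuleCat.{max u v w} K) (c : K)
    (m : ∀ x, G.obj x) : (c • (show totalModule G from m) : totalModule G) = c • m := by
  change totalAction G (algebraMap K _ c) m = c • m
  rw [AlgHom.commutes, Module.algebraMap_end_apply]

/-- The component of the module given by a representation is the value of the representation. -/
noncomputable def componentTotalModule [DecidableEq (Reach V)]
    (G : Reach V ⥤ ModuleCat.{max u v w} K) (x : Reach V) :
    component (totalModule G) x ≃ₗ[K] G.obj x where
  toFun m := (show ∀ x, G.obj x from m.1) x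
  map_add' _ _ := rfl
  map_smul' c m := congrFun (totalModule_algebra_smul G c m.1) x
  invFun g := ⟨Pi.single (M := fun x => G.obj x) x g, by
    refine (totalAction_arrow G (le_refl x) _).trans ?_
    change Pi.single (M := fun x => G.obj x) x ((G.map (𝟙 x)).hom (Pi.single (M := fun x => G.obj x) x g x)) = _
    rw [G.map_id, Pi.single_eq_same]
    rfl⟩
  left_inv m := by
    refine Subtype.ext ?_
    refine Eq.trans ?_ m.2
    refine Eq.trans ?_ (totalAction_arrow G (le_refl x) _).symm
    exact (congrArg (fun f : G.obj x ⟶ G.obj x => Pi.single (M := fun x => G.obj x) x (f.hom _))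
      (G.map_id x)).symm
  right_inv g := Pi.single_eq_same (M := fun x => G.obj x) x g

instance : (representationFunctor K V).EssSurj where
  mem_essImage G := by
    classical
    refine ⟨totalModule G, ⟨NatIso.ofComponents
      (fun x => (componentTotalModule G x).toModuleIso) fun {x y} f => ?_⟩⟩
    ext m
    exact (congrFun (totalAction_arrow G (leOfHom f) _) y).trans
      (Pi.single_eq_same (M := fun x => G.obj x) y _)

instance : (representationFunctor K V).IsEquivalence where

theorem isMoritaEquivalent_of_equivalence {V' : Type u} [Quiver.{v} V'] [Finite V']
    (e : Reach V ≌ Reach V') :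
    IsMoritaEquivalent K (CommutingAlgebra K V) (CommutingAlgebra K V') := by
  let E := ((representationFunctor K V).asEquivalence.trans
    (e.congrLeft (E := ModuleCat.{max u v w} K))).trans
    (representationFunctor K V').asEquivalence.symm
  have h1 : ((representationFunctor K V').asEquivalence.functor).Linear K :=
    inferInstanceAs ((representationFunctor K V').Linear K)
  have h2 : ((representationFunctor K V').asEquivalence.inverse).Linear K :=
    (representationFunctor K V').asEquivalence.inverseLinear K
  have h3 : (e.congrLeft (E := ModuleCat.{max u v w} K)).functor.Additive := ⟨rfl⟩
  have h4 : (e.congrLeft (E := ModuleCat.{max u v w} K)).functor.Linear K := ⟨fun _ _ => rfl⟩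
  have h5 : E.functor.Linear K :=
    inferInstanceAs (((representationFunctor K V) ⋙
      (e.congrLeft (E := ModuleCat.{max u v w} K)).functor ⋙
      (representationFunctor K V').asEquivalence.inverse).Linear K)
  exact ⟨⟨⟨E, h5⟩⟩⟩

end

end CommutingAlgebra

section

variable {C : Type*} [Category* C] [Limits.HasZeroMorphisms C]
  {D : Type*} [Category* D] [Limits.HasZeroMorphisms D]

/-- A projective object with a nonzero identity, all of whose nonzero endomorphisms are
isomorphisms. -/
structure IsProjectiveBrick (X : C) : Prop where
  projective : Projective X
  id_ne_zero : 𝟙 X ≠ 0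
  isIso_of_ne_zero : ∀ f : X ⟶ X, f ≠ 0 → IsIso f

theorem IsProjectiveBrick.map_equivalence {X : C} (hX : IsProjectiveBrick X) (e : C ≌ D) :
    IsProjectiveBrick (e.functor.obj X) where
  projective := (e.map_projective_iff X).2 hX.projective
  id_ne_zero h := hX.id_ne_zero (e.functor.map_injective (by
    rw [e.functor.map_id, h, Functor.map_zero]))
  isIso_of_ne_zero f hf := by
    obtain ⟨g, rfl⟩ := e.functor.map_surjective f
    have := hX.isIso_of_ne_zero g (by rintro rfl; exact hf (e.functor.map_zero _ _))
    infer_instance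

/-- A projective brick is isomorphic to every projective brick through which one of its nonzero
endomorphisms factors. -/
theorem IsProjectiveBrick.nonempty_iso {X Y : C} (hX : IsProjectiveBrick X)
    (hY : IsProjectiveBrick Y) (f : X ⟶ Y) (g : Y ⟶ X) (h : f ≫ g ≠ 0) : Nonempty (X ≅ Y) := by
  have h1 : IsIso (f ≫ g) := hX.isIso_of_ne_zero _ h
  have h2 : IsIso (g ≫ f) := by
    refine hY.isIso_of_ne_zero _ fun h0 => h ?_
    rw [← cancel_mono (f ≫ g), Category.assoc, reassoc_of% h0]
    simp
  have h3 : Mono f := mono_of_mono f g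
  have h4 : IsSplitEpi f := IsSplitEpi.mk' ⟨inv (g ≫ f) ≫ g, by simp⟩
  have : IsIso f := isIso_of_mono_of_isSplitEpi f
  exact ⟨asIso f⟩

end

namespace CommutingAlgebra

section

variable (K : Type w) [CommRing K] {V : Type u} [Quiver.{v} V] [Finite V]

theorem arrow_mul_mul_arrow {x y : Reach V} (h : x ≤ y) (a : CommutingAlgebra K V) :
    ∃ c : K, arrow K (le_refl y) * a * arrow K (le_refl x) = c • arrow K h := by
  induction a using induction_on with
  | zero => exact ⟨0, by simp⟩
  | add b c hb hc =>
    obtain ⟨r, hr⟩ := hb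
    obtain ⟨s, hs⟩ := hc
    exact ⟨r + s, by rw [mul_add, add_mul, hr, hs, add_smul]⟩
  | smul r z t h' =>
    rw [mul_smul_comm, smul_mul_assoc]
    by_cases hy : t = y
    · subst hy
      rw [arrow_mul_arrow]
      by_cases hx : x = z
      · subst hx
        exact ⟨r, by rw [arrow_mul_arrow]⟩
      · exact ⟨0, by rw [arrow_mul_arrow_of_ne K _ _ hx, smul_zero, zero_smul]⟩
    · exact ⟨0, by rw [arrow_mul_arrow_of_ne K _ _ hy, zero_mul, smul_zero, zero_smul]⟩

theorem arrow_mul_mul_arrow_of_not_le {x y : Reach V} (h : ¬ x ≤ y) (a : CommutingAlgebra K V) :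
    arrow K (le_refl y) * a * arrow K (le_refl x) = 0 := by
  induction a using induction_on with
  | zero => simp
  | add b c hb hc => rw [mul_add, add_mul, hb, hc, add_zero]
  | smul r z t h' =>
    rw [mul_smul_comm, smul_mul_assoc]
    by_cases hy : t = y
    · subst hy
      rw [arrow_mul_arrow]
      by_cases hx : x = z
      · subst hx
        exact absurd h' h
      · rw [arrow_mul_arrow_of_ne K _ _ hx, smul_zero]
    · rw [arrow_mul_arrow_of_ne K _ _ hy, zero_mul, smul_zero]

/-- The left ideal generated by the idempotent at a vertex. -/
noncomputable abbrev vertexIdeal (x : Reach V) : Ideal (CommutingAlgebra K V) :=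
  Ideal.span {arrow K (le_refl x)}

theorem mem_vertexIdeal {x : Reach V} {a : CommutingAlgebra K V} :
    a ∈ vertexIdeal K x ↔ a * arrow K (le_refl x) = a := by
  rw [Ideal.mem_span_singleton']
  refine ⟨?_, fun h => ⟨a, h⟩⟩
  rintro ⟨b, rfl⟩
  rw [mul_assoc, arrow_mul_arrow]

/-- The generator of the left ideal at a vertex. -/
noncomputable def vertexGenerator (x : Reach V) : vertexIdeal K x :=
  ⟨arrow K (le_refl x), Ideal.mem_span_singleton_self _⟩

theorem smul_vertexGenerator {x : Reach V} (a : vertexIdeal K x) :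
    (a : CommutingAlgebra K V) • vertexGenerator K x = a :=
  Subtype.ext ((mem_vertexIdeal K).1 a.2)

theorem vertexIdeal_hom_ext {x : Reach V} {M : Type*} [AddCommGroup M]
    [Module (CommutingAlgebra K V) M] {f g : vertexIdeal K x →ₗ[CommutingAlgebra K V] M}
    (h : f (vertexGenerator K x) = g (vertexGenerator K x)) : f = g := by
  ext a
  rw [← smul_vertexGenerator K a, map_smul, map_smul, h]

/-- Right multiplication by the idempotent at a vertex. -/
noncomputable def toVertexIdeal (x : Reach V) :
    CommutingAlgebra K V →ₗ[CommutingAlgebra K V] vertexIdeal K x :=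
  LinearMap.toSpanSingleton _ _ (vertexGenerator K x)

theorem projective_vertexIdeal (x : Reach V) :
    Module.Projective (CommutingAlgebra K V) (vertexIdeal K x) :=
  Module.Projective.of_split (vertexIdeal K x).subtype (toVertexIdeal K x)
    (LinearMap.ext fun a => smul_vertexGenerator K a)

theorem coe_hom_vertexGenerator {x y : Reach V}
    (f : vertexIdeal K y →ₗ[CommutingAlgebra K V] vertexIdeal K x) :
    arrow K (le_refl y) * (f (vertexGenerator K y) : CommutingAlgebra K V) *
      arrow K (le_refl x) = f (vertexGenerator K y) := by
  rw [mul_assoc, (mem_vertexIdeal K).1 (f (vertexGenerator K y)).2, ← smul_eq_mul,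
    ← Submodule.coe_smul, ← map_smul]
  congr 2
  exact smul_vertexGenerator K (vertexGenerator K y)

theorem exists_hom_vertexIdeal_ne_zero_iff [Nontrivial K] {x y : Reach V} :
    (∃ f : vertexIdeal K y →ₗ[CommutingAlgebra K V] vertexIdeal K x, f ≠ 0) ↔ x ≤ y := by
  constructor
  · rintro ⟨f, hf⟩
    by_contra hxy
    refine hf (vertexIdeal_hom_ext K (Subtype.ext ?_))
    rw [← coe_hom_vertexGenerator, arrow_mul_mul_arrow_of_not_le K hxy]
    rfl
  · intro h
    refine ⟨(LinearMap.toSpanSingleton _ _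
      (⟨arrow K h, by rw [mem_vertexIdeal, arrow_mul_arrow]⟩ : vertexIdeal K x)).comp
      (vertexIdeal K y).subtype, fun h0 => ?_⟩
    have := congrArg (Subtype.val) (LinearMap.congr_fun h0 (vertexGenerator K y))
    change arrow K (le_refl y) * arrow K h = 0 at this
    rw [arrow_mul_arrow] at this
    exact arrow_ne_zero K h this

end

section

variable (K : Type w) [Field K] {V : Type u} [Quiver.{v} V] [Finite V]

theorem isUnit_end_vertexIdeal {x : Reach V}
    (f : vertexIdeal K x →ₗ[CommutingAlgebra K V] vertexIdeal K x) (hf : f ≠ 0) :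
    Function.Bijective f := by
  obtain ⟨c, hc⟩ := arrow_mul_mul_arrow K (le_refl x)
    (f (vertexGenerator K x) : CommutingAlgebra K V)
  rw [coe_hom_vertexGenerator] at hc
  have hfc : ∀ a, f a = c • a := by
    intro a
    refine Subtype.ext ?_
    rw [← smul_vertexGenerator K a, map_smul, Submodule.coe_smul, hc, smul_comm]
    rfl
  have hc0 : c ≠ 0 := by
    rintro rfl
    exact hf (LinearMap.ext fun a => by rw [hfc, zero_smul]; rfl)
  refine ⟨fun a b hab => ?_, fun a => ⟨c⁻¹ • a, ?_⟩⟩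
  · rw [hfc, hfc] at hab
    rw [← inv_smul_smul₀ hc0 a, hab, inv_smul_smul₀ hc0]
  · rw [hfc, smul_inv_smul₀ hc0]

/-- The projective module at a vertex, as an object of the category of modules. -/
noncomputable abbrev vertexModule (x : Reach V) : ModuleCat.{max u v w} (CommutingAlgebra K V) :=
  ModuleCat.of _ (vertexIdeal K x)

theorem exists_vertexModule_hom_ne_zero_iff {x y : Reach V} :
    (∃ f : vertexModule K y ⟶ vertexModule K x, f ≠ 0) ↔ x ≤ y := by
  rw [← exists_hom_vertexIdeal_ne_zero_iff K]
  constructor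
  · rintro ⟨f, hf⟩
    exact ⟨f.hom, fun h => hf (ModuleCat.hom_ext h)⟩
  · rintro ⟨f, hf⟩
    exact ⟨ModuleCat.ofHom f, fun h => hf (congrArg ModuleCat.Hom.hom h)⟩

theorem isProjectiveBrick_vertexModule (x : Reach V) : IsProjectiveBrick (vertexModule K x) where
  projective := by
    have := projective_vertexIdeal K x
    exact ModuleCat.projective_of_categoryTheory_projective (vertexModule K x)
  id_ne_zero h := by
    obtain ⟨f, hf⟩ := (exists_vertexModule_hom_ne_zero_iff K).2 (le_refl x)
    exact hf (by rw [← Category.comp_id f, h, Limits.comp_zero])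
  isIso_of_ne_zero f hf := by
    have := isUnit_end_vertexIdeal K f.hom fun h => hf (ModuleCat.hom_ext h)
    exact (ConcreteCategory.isIso_iff_bijective f).2 this

theorem exists_iso_vertexModule {M : ModuleCat.{max u v w} (CommutingAlgebra K V)}
    (hM : IsProjectiveBrick M) : ∃ x : Reach V, Nonempty (M ≅ vertexModule K x) := by
  have : Fintype (Reach V) := Fintype.ofFinite _
  have := hM.projective
  have hproj : Module.Projective (CommutingAlgebra K V) M :=
    ModuleCat.projective_of_module_projective M
  obtain ⟨s, hs⟩ := hproj.out
  obtain ⟨m, hm⟩ : ∃ m : M, m ≠ 0 := by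
    by_contra! h
    exact hM.id_ne_zero (by ext m; exact h m)
  obtain ⟨n, hn⟩ : ∃ n : M, s m n • n ≠ 0 := by
    by_contra! h
    refine hm ((hs m).symm.trans ?_)
    rw [Finsupp.linearCombination_apply]
    exact Finset.sum_eq_zero fun n _ => h n
  obtain ⟨x, hx⟩ : ∃ x : Reach V, (s m n * arrow K (le_refl x)) • n ≠ 0 := by
    by_contra! h
    refine hn ?_
    rw [← mul_one (s m n), ← sum_arrow K, Finset.mul_sum, Finset.sum_smul]
    exact Finset.sum_eq_zero fun x _ => h x
  refine ⟨x, hM.nonempty_iso (isProjectiveBrick_vertexModule K x)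
    (ModuleCat.ofHom ((toVertexIdeal K x).comp ((Finsupp.lapply n).comp s)))
    (ModuleCat.ofHom ((LinearMap.toSpanSingleton _ _ n).comp (vertexIdeal K x).subtype))
    fun h0 => hx ?_⟩
  exact ConcreteCategory.congr_hom h0 m

variable {K}
variable {V' : Type u} [Quiver.{v} V'] [Finite V']

theorem le_iff_le_of_iso
    (E : ModuleCat.{max u v w} (CommutingAlgebra K V) ≌
      ModuleCat.{max u v w} (CommutingAlgebra K V')) {x y : Reach V} {x' y' : Reach V'}
    (ex : E.functor.obj (vertexModule K x) ≅ vertexModule K x')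
    (ey : E.functor.obj (vertexModule K y) ≅ vertexModule K y') : x' ≤ y' ↔ x ≤ y := by
  rw [← exists_vertexModule_hom_ne_zero_iff K, ← exists_vertexModule_hom_ne_zero_iff K]
  constructor
  · rintro ⟨f, hf⟩
    obtain ⟨g, hg⟩ := E.functor.map_surjective (ey.hom ≫ f ≫ ex.inv)
    refine ⟨g, ?_⟩
    rintro rfl
    refine hf ?_
    rw [E.functor.map_zero] at hg
    rw [← cancel_epi ey.hom, ← cancel_mono ex.inv, Category.assoc, ← hg]
    simp
  · rintro ⟨f, hf⟩
    refine ⟨ey.inv ≫ E.functor.map f ≫ ex.hom, fun h0 => hf (E.functor.map_injective ?_)⟩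
    rw [← cancel_epi ey.inv, ← cancel_mono ex.hom, Category.assoc, h0]
    simp

theorem exists_reach_map_of_equivalence
    (E : ModuleCat.{max u v w} (CommutingAlgebra K V) ≌
      ModuleCat.{max u v w} (CommutingAlgebra K V')) :
    ∃ g : Reach V → Reach V', (∀ x y, g x ≤ g y ↔ x ≤ y) ∧
      ∀ y, ∃ x, AntisymmRel (· ≤ ·) (g x) y := by
  choose g hg using fun x => exists_iso_vertexModule K
    ((isProjectiveBrick_vertexModule K x).map_equivalence E)
  refine ⟨g, fun x y => le_iff_le_of_iso E (hg x).some (hg y).some, fun y => ?_⟩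
  obtain ⟨x, ⟨i⟩⟩ := exists_iso_vertexModule K
    ((isProjectiveBrick_vertexModule K y).map_equivalence E.symm)
  have j : E.functor.obj (vertexModule K x) ≅ vertexModule K y :=
    E.functor.mapIso i.symm ≪≫ E.counitIso.app _
  exact ⟨x, (le_iff_le_of_iso E (hg x).some j).2 le_rfl, (le_iff_le_of_iso E j (hg x).some).2 le_rfl⟩

end

end CommutingAlgebra

section Antisymmetrization

variable {P P' : Type*} [Preorder P] [Preorder P']

theorem nonempty_antisymmetrization_orderIso (g : P → P') (hg : ∀ x y, g x ≤ g y ↔ x ≤ y)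
    (hsurj : ∀ y, ∃ x, AntisymmRel (· ≤ ·) (g x) y) :
    Nonempty (Antisymmetrization P (· ≤ ·) ≃o Antisymmetrization P' (· ≤ ·)) := by
  let f : Antisymmetrization P (· ≤ ·) →o Antisymmetrization P' (· ≤ ·) :=
    OrderHom.antisymmetrization ⟨g, fun x y h => (hg x y).2 h⟩
  refine ⟨RelIso.ofSurjective (OrderEmbedding.ofMapLEIff f ?_) ?_⟩
  · intro a b
    induction a using Antisymmetrization.ind
    induction b using Antisymmetrization.ind
    exact hg _ _
  · intro b
    induction b using Antisymmetrization.ind with | _ y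
    obtain ⟨x, hx⟩ := hsurj y
    exact ⟨toAntisymmetrization _ x, Quotient.sound hx⟩

/-- Preorders with isomorphic antisymmetrizations are equivalent categories. -/
theorem nonempty_equivalence_of_antisymmetrization_orderIso {P P' : Type u} [Preorder P]
    [Preorder P'] (e : Antisymmetrization P (· ≤ ·) ≃o Antisymmetrization P' (· ≤ ·)) :
    Nonempty (P ≌ P') := by
  let g : P → P' := fun x => ofAntisymmetrization (· ≤ ·) (e (toAntisymmetrization (· ≤ ·) x))
  have hg : ∀ x y, g x ≤ g y ↔ x ≤ y := fun x y => by
    rw [ofAntisymmetrization_le_ofAntisymmetrization_iff, e.le_iff_le,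
      toAntisymmetrization_le_toAntisymmetrization_iff]
  let F : P ⥤ P' := Monotone.functor (f := g) fun x y h => (hg x y).2 h
  have : F.Full := ⟨fun f => ⟨homOfLE ((hg _ _).1 (leOfHom f)), Subsingleton.elim _ _⟩⟩
  have : F.Faithful := ⟨fun _ => Subsingleton.elim _ _⟩
  have : F.EssSurj := by
    refine ⟨fun y => ?_⟩
    let x := ofAntisymmetrization (· ≤ ·) (e.symm (toAntisymmetrization (· ≤ ·) y))
    have h : toAntisymmetrization (· ≤ ·) (g x) = toAntisymmetrization (· ≤ ·) y := by
      rw [toAntisymmetrization_ofAntisymmetrization, toAntisymmetrization_ofAntisymmetrization,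
        e.apply_symm_apply]
    have h' : AntisymmRel (· ≤ ·) (g x) y := Quotient.exact h
    exact ⟨x, ⟨⟨homOfLE h'.1, homOfLE h'.2, Subsingleton.elim _ _, Subsingleton.elim _ _⟩⟩⟩
  have : F.IsEquivalence := {}
  exact ⟨F.asEquivalence⟩

end Antisymmetrization

/-- Morita equivalence is stated both for the underlying rings (an equivalence of the categories of
left modules) and for `K`-algebras (a `K`-linear such equivalence). -/
theorem mainTheorem1 (K : Type w) [Field K]
    (V V' : Type u) [Quiver.{v} V] [Quiver.{v} V'] [Finite V] [Finite V']
    [∀ a b : V, Finite (a ⟶ b)] [∀ a b : V', Finite (a ⟶ b)] :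
    (Nonempty (ModuleCat.{max u v w} (CommutingAlgebra K V) ≌
        ModuleCat.{max u v w} (CommutingAlgebra K V')) ↔
      Nonempty (ReachabilityPoset V ≃o ReachabilityPoset V')) ∧
    (IsMoritaEquivalent K (CommutingAlgebra K V) (CommutingAlgebra K V') ↔
      Nonempty (ReachabilityPoset V ≃o ReachabilityPoset V')) := by
  have hring : Nonempty (ModuleCat.{max u v w} (CommutingAlgebra K V) ≌
      ModuleCat.{max u v w} (CommutingAlgebra K V')) →
      Nonempty (ReachabilityPoset V ≃o ReachabilityPoset V') := by
    rintro ⟨E⟩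
    obtain ⟨g, hg, hsurj⟩ := CommutingAlgebra.exists_reach_map_of_equivalence E
    exact nonempty_antisymmetrization_orderIso g hg hsurj
  have hposet : Nonempty (ReachabilityPoset V ≃o ReachabilityPoset V') →
      IsMoritaEquivalent K (CommutingAlgebra K V) (CommutingAlgebra K V') := by
    rintro ⟨e⟩
    obtain ⟨F⟩ := nonempty_equivalence_of_antisymmetrization_orderIso e
    exact CommutingAlgebra.isMoritaEquivalent_of_equivalence F
  have hmorita : IsMoritaEquivalent K (CommutingAlgebra K V) (CommutingAlgebra K V') →
      Nonempty (ModuleCat.{max u v w} (CommutingAlgebra K V) ≌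
        ModuleCat.{max u v w} (CommutingAlgebra K V')) := fun h => h.cond.map fun e => e.eqv
  exact ⟨⟨hring, hmorita ∘ hposet⟩, ⟨hring ∘ hmorita, hposet⟩⟩
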